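/- **Theorem 1.2.** Let $(G^{(n)})_{n\ge 1}$ be a sequence of finite groups with $|G^{(n)}|\to\infty$, and let $H^{(n)}\trianglelefteq G^{(n)}$ be normal Abelian subgroups with $\sup_n |G^{(n)}|/|H^{(n)}|<\infty$. Let $k=k_n\in\mathbb N$ satisfy, as $n\to\infty$, $$\log|G^{(n)}| = o(k_n)\quad\text{and}\quad \log k_n=o(\log |G^{(n)}|).$$ For each $n$ let $Z_1,\dots,Z_k$ be i.i.d. uniformly distributed elements of $G=G^{(n)}$, and let $\mathcal S=\{Z_i^{\pm1}:1\le i\le k\}$, regarded as a multiset with $2k$ elements. Let $P(x,y)=\frac1{2k}\#\{s\in\mathcal S: xs=y\}$ (counted with multiplicity) be the transition matrix of the simple random walk on the Cayley graph $\mathrm{Cay}(G,\mathcal S)$, let $P_t=\sum_{j\ge0}e^{-t}\frac{t^j}{j!}P^j$ be that of its rate-1 continuous-time version, and let $$d_{\mathcal S}(t)=\max_{x\in G}\frac12\sum_{y\in G}\Bigl|P_t(x,y)-\frac1{|G|}\Bigr| .$$ Then the walk exhibits cutoff with high probability at time $$t_0=\frac{\log|G|}{\log(k/\log|G|)},$$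 that is, as $n\to\infty$, $d_{\mathcal S}((1-\varepsilon)t_0)\to 1$ in probability for every $\varepsilon\in(0,1)$, and $d_{\mathcal S}((1+\varepsilon)t_0)\to 0$ in probability for every $\varepsilon>0$, where the probability is over the choice of $Z_1,\dots,Z_k$. -/

import Mathlib

open MeasureTheory ProbabilityTheory Filter Topology Asymptotics

noncomputable section

/-- The multiset of generators `{z_i, z_i⁻¹ : i}`. Multiplicities are kept, so it has
exactly `2 * k` elements. -/
def generators {G : Type*} [Group G] {k : ℕ} (z : Fin k → G) : Multiset G :=
  Finset.univ.val.map z + Finset.univ.val.map (fun i => (z i)⁻¹)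

open Classical in
/-- Transition matrix of the discrete-time simple random walk on the right Cayley multigraph
`Cay(G, S)`: from `x` move to `x * s`, where `s` is drawn uniformly from the multiset `S`. -/
def stepMatrix {G : Type*} [Group G] (S : Multiset G) : Matrix G G ℝ :=
  fun x y => (S.count (x⁻¹ * y) : ℝ) / (S.card : ℝ)

open Classical in
/-- Transition probabilities `P_t(x, y) = ∑_j e^{-t} t^j / j! * P^j(x, y)` of the rate-1
continuous-time simple random walk on `Cay(G, S)`. -/
def heatKernel {G : Type*} [Group G] [Fintype G] (S : Multiset G) (t : ℝ) (x y : G) : ℝ :=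
  ∑' j : ℕ, Real.exp (-t) * (t ^ j / (j.factorial : ℝ)) * (stepMatrix S ^ j) x y

/-- Worst-case total variation distance at time `t` of the rate-1 walk on `Cay(G, S)` to the
uniform distribution on `G`. -/
def tvDist {G : Type*} [Group G] [Fintype G] (S : Multiset G) (t : ℝ) : ℝ :=
  ⨆ x : G, (1 / 2 : ℝ) * ∑ y : G, |heatKernel S t x y - 1 / (Fintype.card G : ℝ)|

/-- A sequence of random walks on Cayley graphs with random generating multisets `S n`
(defined on probability spaces `(Ω n, μ n)`) exhibits cutoff with high probability at the times
`t₀ n`: the total variation distance at time `(1 - ε) t₀` is `1 - o(1)` and at time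
`(1 + ε) t₀` is `o(1)`, in probability over the generators. In the lower part `ε < 1`, so that
the time `(1 - ε) t₀` is not negative. -/
def CutoffWHP {G : ℕ → Type*} [∀ n, Group (G n)] [∀ n, Fintype (G n)]
    {Ω : ℕ → Type*} [∀ n, MeasurableSpace (Ω n)] (μ : ∀ n, Measure (Ω n))
    (S : ∀ n, Ω n → Multiset (G n)) (t₀ : ℕ → ℝ) : Prop :=
  (∀ ε : ℝ, 0 < ε → ε < 1 → ∀ δ : ℝ, 0 < δ →
    Tendsto (fun n => μ n {ω | 1 - δ ≤ tvDist (S n ω) ((1 - ε) * t₀ n)}) atTop (𝓝 1)) ∧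
  (∀ ε : ℝ, 0 < ε → ∀ δ : ℝ, 0 < δ →
    Tendsto (fun n => μ n {ω | tvDist (S n ω) ((1 + ε) * t₀ n) ≤ δ}) atTop (𝓝 1))

end

/-!
The two halves of the cutoff have independent reasons. Write `N = log |G|`, `L = log (k / N)` and
`t₀ = N / L`. Since `N = o(k)` and `log k = o(N)`, both `L` and `t₀` tend to infinity, so the Poisson
number of steps made by time `c * t₀` is concentrated around `c * t₀` (`poissonMass_le`), and it
suffices to look at words of a fixed length `M` in the letters `z i` and `(z i)⁻¹`.

**Upper bound.** This half holds for all groups. By Cauchy–Schwarz and the symmetry of the transition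
matrix, the squared `ℓ¹` distance of the `M`-step law to uniform is at most
`|G| * P ^ (2 * M) (1, 1) - 1` (`wordDist_sq_le`). Average over the generators: if some generator
occurs exactly once in a word of length `2 * M`, then the value of the word is uniform on `G`, so it
is `1` with probability `1 / |G|` (`card_wordVal_eq_one_mul_le`). In the remaining words at most `M`
generators occur, so their proportion is at most `(k choose M) * (M / k) ^ (2 * M)`, which is at most
`(e * M / k) ^ M` (`card_words_no_single_le`, `average_return_le`). For `M ≈ (1 + ε / 2) * t₀` this is
`o(1 / |G|)` (`exp_mul_pow_le`), and Markov's inequality concludes.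

**Lower bound.** This half is deterministic in the generators and uses the Abelian subgroup `H`. By
Schreier rewriting, a word is a product of elements of `H`, each depending only on a letter and on
the `H`-coset of the prefix before it, times a coset representative. As `H` is Abelian, only the
multiset of pairs (coset, letter) matters (`exists_sym_out_mul_wordVal`). With `q` the index of `H`,
words of length at most `M` therefore spell at most `q * (M + 2 * k * q choose M)` elements
(`card_reach_le`), and for `M ≈ (1 - ε / 2) * t₀` this is `o(|G|)` (`pow_le_exp`), while the uniform
law needs almost all of `G` (`le_tvDist`).
-/

/-! ### Words in the generators and the powers of the transition matrix -/

section Words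

variable {G : Type*} [Group G] {k : ℕ}

/-- The element of the generating multiset named by a letter: `(i, true)` stands for `z i` and
`(i, false)` for its inverse. -/
def letterVal (z : Fin k → G) (a : Fin k × Bool) : G :=
  if a.2 then z a.1 else (z a.1)⁻¹

/-- The group element spelled by a word of length `j` in the letters, read from left to right. -/
def wordVal (z : Fin k → G) {j : ℕ} (w : Fin j → Fin k × Bool) : G :=
  (List.ofFn fun m => letterVal z (w m)).prod

@[simp]
lemma wordVal_zero (z : Fin k → G) (w : Fin 0 → Fin k × Bool) : wordVal z w = 1 := by
  simp [wordVal]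

lemma wordVal_succ (z : Fin k → G) {j : ℕ} (w : Fin (j + 1) → Fin k × Bool) :
    wordVal z w = letterVal z (w 0) * wordVal z (fun m => w m.succ) := by
  simp [wordVal, List.ofFn_succ]

lemma card_generators (z : Fin k → G) : (generators z).card = 2 * k := by
  simp [generators, two_mul]

lemma generators_eq_map (z : Fin k → G) :
    generators z = (Finset.univ : Finset (Fin k × Bool)).val.map (letterVal z) := by
  have h : (Finset.univ : Finset (Fin k × Bool)).val
      = (Finset.univ : Finset (Fin k)).val.map (fun i => (i, true))
        + (Finset.univ : Finset (Fin k)).val.map (fun i => (i, false)) := by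
    refine (Multiset.Nodup.ext (Finset.nodup _) ?_).2 ?_
    · refine (Multiset.nodup_add).2 ⟨?_, ?_, ?_⟩
      · exact Multiset.Nodup.map (fun a b h => by simpa using h) (Finset.nodup _)
      · exact Multiset.Nodup.map (fun a b h => by simpa using h) (Finset.nodup _)
      · rw [Multiset.disjoint_left]
        simp
    · rintro ⟨i, b⟩
      cases b <;> simp
  rw [h, Multiset.map_add, Multiset.map_map, Multiset.map_map]
  simp [generators, letterVal, Function.comp_def]

open Classical in
lemma stepMatrix_generators_apply (z : Fin k → G) (x y : G) :
    stepMatrix (generators z) x y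
      = (∑ a : Fin k × Bool, if x * letterVal z a = y then (1 : ℝ) else 0) / (2 * k : ℝ) := by
  unfold stepMatrix
  rw [card_generators, generators_eq_map, Multiset.count_map]
  push_cast
  congr 1
  rw [Finset.sum_boole]
  norm_cast
  rw [← Finset.card_val, Finset.filter_val]
  congr 1
  refine Multiset.filter_congr fun a _ => ?_
  rw [inv_mul_eq_iff_eq_mul, eq_comm]

lemma stepMatrix_isSymm (z : Fin k → G) : (stepMatrix (generators z)).IsSymm := by
  classical
  have hinv : (generators z).map (fun g => g⁻¹) = generators z := by
    rw [generators, Multiset.map_add, Multiset.map_map, Multiset.map_map, add_comm]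
    simp only [Function.comp_def, inv_inv]
  ext x y
  rw [Matrix.transpose_apply]
  unfold stepMatrix
  congr 2
  rw [show y⁻¹ * x = (x⁻¹ * y)⁻¹ by simp]
  conv_lhs => rw [← hinv]
  exact Multiset.count_map_eq_count' (fun g : G => g⁻¹) _ inv_injective _

lemma sum_words_succ {j : ℕ} (f : (Fin (j + 1) → Fin k × Bool) → ℝ) :
    ∑ w, f w = ∑ a, ∑ w : Fin j → Fin k × Bool, f (Fin.cons a w) := by
  rw [← Fintype.sum_prod_type', ← (Fin.consEquiv fun _ => Fin k × Bool).sum_comp]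
  rfl

open Classical in
/-- The law of the discrete-time walk started at the identity after `j` steps: the proportion of
words of length `j` that spell `g`. -/
noncomputable def wordLaw (z : Fin k → G) (j : ℕ) (g : G) : ℝ :=
  (∑ w : Fin j → Fin k × Bool, if wordVal z w = g then (1 : ℝ) else 0) / (2 * k : ℝ) ^ j

open Classical in
lemma wordLaw_succ (z : Fin k → G) (j : ℕ) (g : G) :
    wordLaw z (j + 1) g
      = (∑ a : Fin k × Bool, wordLaw z j ((letterVal z a)⁻¹ * g)) / (2 * k : ℝ) := by
  unfold wordLaw
  rw [sum_words_succ, ← Finset.sum_div, div_div, pow_succ]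
  congr 1
  refine Finset.sum_congr rfl fun a _ => Finset.sum_congr rfl fun w _ => ?_
  simp only [wordVal_succ, Fin.cons_zero, Fin.cons_succ, eq_inv_mul_iff_mul_eq]

open Classical in
lemma stepMatrix_pow_apply [Fintype G] (z : Fin k → G) (j : ℕ) (x y : G) :
    (stepMatrix (generators z) ^ j) x y = wordLaw z j (x⁻¹ * y) := by
  induction j generalizing x with
  | zero =>
    simp [wordLaw, Matrix.one_apply, eq_inv_mul_iff_mul_eq]
  | succ j ih =>
    rw [pow_succ', Matrix.mul_apply, wordLaw_succ]
    simp_rw [ih, stepMatrix_generators_apply, div_mul_eq_mul_div, ← Finset.sum_div,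
      Finset.sum_mul]
    rw [Finset.sum_comm]
    congr 1
    refine Finset.sum_congr rfl fun a _ => ?_
    simp [mul_assoc]

lemma wordLaw_nonneg (z : Fin k → G) (j : ℕ) (g : G) : 0 ≤ wordLaw z j g := by
  unfold wordLaw
  positivity

variable [Fintype G]

open Classical in
lemma sum_wordLaw (z : Fin k → G) (hk : 0 < k) (j : ℕ) : ∑ g, wordLaw z j g = 1 := by
  have hk' : (0 : ℝ) < k := by exact_mod_cast hk
  unfold wordLaw
  rw [← Finset.sum_div, Finset.sum_comm]
  simp only [Finset.sum_ite_eq, Finset.mem_univ, if_true, Finset.sum_const, Finset.card_univ,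
    Fintype.card_fun, Fintype.card_prod, Fintype.card_fin, Fintype.card_bool, nsmul_eq_mul,
    mul_one, Nat.cast_pow, Nat.cast_mul, Nat.cast_ofNat]
  rw [mul_comm]
  exact div_self (by positivity)

/-- The collision probability of two independent walks of `j` steps is the return probability of
one walk of `2 * j` steps, since the generating multiset is closed under inversion. -/
lemma sum_wordLaw_sq (z : Fin k → G) (j : ℕ) :
    ∑ g, wordLaw z j g ^ 2 = wordLaw z (2 * j) 1 := by
  classical
  have h := stepMatrix_pow_apply z (2 * j) 1 1
  rw [two_mul, pow_add, Matrix.mul_apply] at h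
  rw [two_mul, show (1 : G) = 1⁻¹ * 1 by simp, ← h]
  refine Finset.sum_congr rfl fun g _ => ?_
  rw [((stepMatrix_isSymm z).pow j).apply 1 g, stepMatrix_pow_apply]
  simp [sq]

/-- The `ℓ¹` distance of the `j`-step law to the uniform distribution. -/
noncomputable def wordDist (z : Fin k → G) (j : ℕ) : ℝ :=
  ∑ g, |wordLaw z j g - 1 / (Fintype.card G : ℝ)|

/-- The law after `j + 1` steps is an average of translates of the law after `j` steps. -/
lemma wordDist_succ_le (z : Fin k → G) (hk : 0 < k) (j : ℕ) :
    wordDist z (j + 1) ≤ wordDist z j := by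
  have hk' : (0 : ℝ) < k := by exact_mod_cast hk
  have hA : (Fintype.card (Fin k × Bool) : ℝ) = 2 * k := by simp [mul_comm]
  have h1 : ∀ g, |wordLaw z (j + 1) g - 1 / (Fintype.card G : ℝ)|
      ≤ (∑ a, |wordLaw z j ((letterVal z a)⁻¹ * g) - 1 / (Fintype.card G : ℝ)|) / (2 * k) := by
    intro g
    have : wordLaw z (j + 1) g - 1 / (Fintype.card G : ℝ)
        = (∑ a, (wordLaw z j ((letterVal z a)⁻¹ * g) - 1 / (Fintype.card G : ℝ))) / (2 * k) := by
      rw [wordLaw_succ, Finset.sum_sub_distrib, Finset.sum_const, Finset.card_univ, nsmul_eq_mul,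
        hA, sub_div]
      field_simp
    rw [this, abs_div, abs_of_pos (by positivity : (0 : ℝ) < 2 * k)]
    gcongr
    exact Finset.abs_sum_le_sum_abs _ _
  calc wordDist z (j + 1)
      ≤ ∑ g, (∑ a, |wordLaw z j ((letterVal z a)⁻¹ * g) - 1 / (Fintype.card G : ℝ)|)
          / (2 * k) := Finset.sum_le_sum fun g _ => h1 g
    _ = (∑ a : Fin k × Bool, wordDist z j) / (2 * k) := by
        rw [← Finset.sum_div, Finset.sum_comm]
        congr 1
        refine Finset.sum_congr rfl fun a _ => ?_
        exact Equiv.sum_comp (Equiv.mulLeft (letterVal z a)⁻¹)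
          (fun g => |wordLaw z j g - 1 / (Fintype.card G : ℝ)|)
    _ = wordDist z j := by
        rw [Finset.sum_const, Finset.card_univ, nsmul_eq_mul, hA]
        field_simp

lemma wordDist_antitone (z : Fin k → G) (hk : 0 < k) : Antitone (wordDist z) :=
  antitone_nat_of_succ_le (wordDist_succ_le z hk)

lemma wordDist_nonneg (z : Fin k → G) (j : ℕ) : 0 ≤ wordDist z j :=
  Finset.sum_nonneg fun _ _ => abs_nonneg _

lemma wordDist_le_two (z : Fin k → G) (hk : 0 < k) (j : ℕ) : wordDist z j ≤ 2 := by
  have hG : (0 : ℝ) < Fintype.card G := by exact_mod_cast Fintype.card_pos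
  calc wordDist z j ≤ ∑ g, (wordLaw z j g + 1 / (Fintype.card G : ℝ)) := by
        refine Finset.sum_le_sum fun g _ => ?_
        refine (abs_sub _ _).trans ?_
        rw [abs_of_nonneg (wordLaw_nonneg z j g), abs_of_pos (by positivity)]
    _ = 2 := by
        rw [Finset.sum_add_distrib, sum_wordLaw z hk, Finset.sum_const, Finset.card_univ,
          nsmul_eq_mul]
        field_simp
        norm_num

/-- Cauchy–Schwarz bound for the distance to uniformity by the return probability. -/
lemma wordDist_sq_le (z : Fin k → G) (hk : 0 < k) (j : ℕ) :
    wordDist z j ^ 2 ≤ Fintype.card G * wordLaw z (2 * j) 1 - 1 := by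
  have hG : (0 : ℝ) < Fintype.card G := by exact_mod_cast Fintype.card_pos
  refine (sq_sum_le_card_mul_sum_sq).trans (le_of_eq ?_)
  simp_rw [sq_abs, sub_sq]
  rw [Finset.sum_add_distrib, Finset.sum_sub_distrib, sum_wordLaw_sq, ← Finset.sum_mul,
    ← Finset.mul_sum, sum_wordLaw z hk, Finset.sum_const, Finset.card_univ, nsmul_eq_mul]
  field_simp
  ring

end Words

/-! ### Poisson weights and total variation bounds for the continuous-time walk -/

section Poisson

/-- The probability that a Poisson variable of mean `t` equals `j`. -/
noncomputable def poissonWeight (t : ℝ) (j : ℕ) : ℝ :=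
  Real.exp (-t) * (t ^ j / (j.factorial : ℝ))

/-- The probability that a Poisson variable of mean `t` lies in `s`. -/
noncomputable def poissonMass (t : ℝ) (s : Set ℕ) : ℝ :=
  ∑' j, s.indicator (poissonWeight t) j

lemma poissonWeight_nonneg {t : ℝ} (ht : 0 ≤ t) (j : ℕ) : 0 ≤ poissonWeight t j := by
  unfold poissonWeight
  positivity

lemma hasSum_pow_div_factorial (t : ℝ) :
    HasSum (fun j : ℕ => t ^ j / (j.factorial : ℝ)) (Real.exp t) := by
  rw [Real.exp_eq_exp_ℝ]
  exact NormedSpace.expSeries_div_hasSum_exp t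

lemma hasSum_poissonWeight (t : ℝ) : HasSum (poissonWeight t) 1 := by
  have h := (hasSum_pow_div_factorial t).mul_left (Real.exp (-t))
  rwa [← Real.exp_add, neg_add_cancel, Real.exp_zero] at h

lemma summable_poissonWeight_mul {t : ℝ} (ht : 0 ≤ t) {f : ℕ → ℝ} {C : ℝ}
    (hf : ∀ j, |f j| ≤ C) : Summable fun j => poissonWeight t j * f j := by
  refine Summable.of_norm_bounded ((hasSum_poissonWeight t).summable.mul_right C) fun j => ?_
  rw [Real.norm_eq_abs, abs_mul, abs_of_nonneg (poissonWeight_nonneg ht j)]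
  exact mul_le_mul_of_nonneg_left (hf j) (poissonWeight_nonneg ht j)

/-- Chernoff bound for both tails: `s` may be any set of integers `≥ a * t` if `1 ≤ a`, and any
set of integers `≤ a * t` if `a ≤ 1`. -/
lemma poissonMass_le {t a : ℝ} (ht : 0 ≤ t) (ha : 0 < a) {s : Set ℕ}
    (hs : ∀ j ∈ s, a * t * Real.log a ≤ j * Real.log a) :
    poissonMass t s ≤ Real.exp (-(t * (1 - a + a * Real.log a))) := by
  have h := ((hasSum_pow_div_factorial (a * t)).mul_left
    (Real.exp (-t) * Real.exp (-(a * t * Real.log a))))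
  have hle : ∀ j, s.indicator (poissonWeight t) j ≤
      Real.exp (-t) * Real.exp (-(a * t * Real.log a)) * ((a * t) ^ j / (j.factorial : ℝ)) := by
    intro j
    by_cases hj : j ∈ s
    · rw [Set.indicator_of_mem hj, poissonWeight]
      have h1 : 1 ≤ Real.exp (-(a * t * Real.log a)) * a ^ j := by
        rw [← Real.exp_log (pow_pos ha j), ← Real.exp_add, Real.log_pow]
        refine Real.one_le_exp ?_
        linarith [hs j hj]
      calc Real.exp (-t) * (t ^ j / (j.factorial : ℝ))
          ≤ Real.exp (-t) * (t ^ j / (j.factorial : ℝ))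
              * (Real.exp (-(a * t * Real.log a)) * a ^ j) :=
            le_mul_of_one_le_right (by positivity) h1
        _ = _ := by rw [mul_pow]; ring
    · rw [Set.indicator_of_notMem hj]
      positivity
  refine (Summable.tsum_le_tsum hle ((hasSum_poissonWeight t).summable.indicator s)
    h.summable).trans (le_of_eq ?_)
  rw [h.tsum_eq, ← Real.exp_add, ← Real.exp_add]
  congr 1
  ring

/-- Positivity of the rate in `poissonMass_le`. -/
lemma poisson_rate_pos {a : ℝ} (ha : 0 < a) (ha1 : a ≠ 1) : 0 < 1 - a + a * Real.log a := by
  have h := Real.log_lt_sub_one_of_pos (inv_pos.2 ha) (by simpa using ha1)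
  rw [Real.log_inv] at h
  have h2 := mul_lt_mul_of_pos_left h ha
  rw [mul_sub, mul_inv_cancel₀ ha.ne'] at h2
  linarith

end Poisson

section HeatKernel

variable {G : Type*} [Group G] [Fintype G] {k : ℕ}

lemma wordLaw_abs_le_one (z : Fin k → G) (hk : 0 < k) (j : ℕ) (g : G) :
    |wordLaw z j g| ≤ 1 := by
  rw [abs_of_nonneg (wordLaw_nonneg z j g), ← sum_wordLaw z hk j]
  exact Finset.single_le_sum (fun g _ => wordLaw_nonneg z j g) (Finset.mem_univ g)

lemma heatKernel_generators (z : Fin k → G) (t : ℝ) (x y : G) :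
    heatKernel (generators z) t x y = ∑' j, poissonWeight t j * wordLaw z j (x⁻¹ * y) := by
  simp only [heatKernel, stepMatrix_pow_apply, poissonWeight]

/-- Before `M` steps the distance is bounded trivially; afterwards by the distance at `M`. -/
lemma tvDist_le (z : Fin k → G) (hk : 0 < k) {t : ℝ} (ht : 0 ≤ t) (M : ℕ) :
    tvDist (generators z) t ≤ poissonMass t (Set.Iio M) + wordDist z M / 2 := by
  refine ciSup_le fun x => ?_
  set c : ℝ := 1 / (Fintype.card G : ℝ) with hc
  have hdist : ∀ j, |wordDist z j| ≤ 2 := fun j => by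
    rw [abs_of_nonneg (wordDist_nonneg z j)]
    exact wordDist_le_two z hk j
  have hterm : ∀ j g, |wordLaw z j g - c| ≤ 2 := fun j g =>
    (Finset.single_le_sum (f := fun g => |wordLaw z j g - c|) (fun _ _ => abs_nonneg _)
      (Finset.mem_univ g)).trans (wordDist_le_two z hk j)
  have hsum : ∀ y, Summable fun j => poissonWeight t j * |wordLaw z j (x⁻¹ * y) - c| :=
    fun y => summable_poissonWeight_mul ht (C := 2) fun j => by
      rw [abs_abs]; exact hterm j _
  have h1 : ∀ y, |heatKernel (generators z) t x y - c|
      ≤ ∑' j, poissonWeight t j * |wordLaw z j (x⁻¹ * y) - c| := by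
    intro y
    have hs := summable_poissonWeight_mul ht fun j => wordLaw_abs_le_one z hk j (x⁻¹ * y)
    have hs' := (hasSum_poissonWeight t).summable.mul_right c
    have : heatKernel (generators z) t x y - c
        = ∑' j, poissonWeight t j * (wordLaw z j (x⁻¹ * y) - c) := by
      simp_rw [mul_sub]
      rw [hs.tsum_sub hs', tsum_mul_right, (hasSum_poissonWeight t).tsum_eq, one_mul,
        heatKernel_generators]
    rw [this]
    have hn : ∀ j, ‖poissonWeight t j * (wordLaw z j (x⁻¹ * y) - c)‖
        = poissonWeight t j * |wordLaw z j (x⁻¹ * y) - c| := fun j => by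
      rw [Real.norm_eq_abs, abs_mul, abs_of_nonneg (poissonWeight_nonneg ht j)]
    have h := norm_tsum_le_tsum_norm (f := fun j => poissonWeight t j *
      (wordLaw z j (x⁻¹ * y) - c)) (by simpa only [hn] using hsum y)
    simp only [hn] at h
    rwa [Real.norm_eq_abs] at h
  have h2 : ∑ y, |heatKernel (generators z) t x y - c|
      ≤ ∑' j, poissonWeight t j * wordDist z j := by
    refine (Finset.sum_le_sum fun y _ => h1 y).trans (le_of_eq ?_)
    rw [← Summable.tsum_finsetSum fun y _ => hsum y]
    refine tsum_congr fun j => ?_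
    rw [← Finset.mul_sum]
    congr 1
    exact Equiv.sum_comp (Equiv.mulLeft x⁻¹) (fun g => |wordLaw z j g - c|)
  have hind := (hasSum_poissonWeight t).summable.indicator (Set.Iio M)
  have hw := (hasSum_poissonWeight t).summable.mul_right (wordDist z M)
  have h3 : ∑' j, poissonWeight t j * wordDist z j
      ≤ 2 * poissonMass t (Set.Iio M) + wordDist z M := by
    have : 2 * poissonMass t (Set.Iio M) + wordDist z M
        = ∑' j, (2 * (Set.Iio M).indicator (poissonWeight t) j
            + poissonWeight t j * wordDist z M) := by
      rw [(hind.mul_left 2).tsum_add hw, tsum_mul_left, tsum_mul_right,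
        (hasSum_poissonWeight t).tsum_eq, one_mul, poissonMass]
    rw [this]
    refine Summable.tsum_le_tsum (fun j => ?_) (summable_poissonWeight_mul ht hdist)
      ((hind.mul_left 2).add hw)
    have hp := poissonWeight_nonneg ht j
    rcases lt_or_ge j M with hj | hj
    · rw [Set.indicator_of_mem (Set.mem_Iio.2 hj)]
      have := mul_le_mul_of_nonneg_left (wordDist_le_two z hk j) hp
      have := mul_nonneg hp (wordDist_nonneg z M)
      linarith
    · rw [Set.indicator_of_notMem (by simpa using hj)]
      have := mul_le_mul_of_nonneg_left (wordDist_antitone z hk hj) hp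
      linarith
  linarith

/-- If the walk cannot leave `A` within `M` steps, it is as far from uniform as the size of `A`
and the probability of more than `M` steps allow. -/
lemma le_tvDist (z : Fin k → G) (hk : 0 < k) {t : ℝ} (ht : 0 ≤ t) (M : ℕ) (A : Finset G)
    (hA : ∀ j ≤ M, ∀ g ∉ A, wordLaw z j g = 0) :
    1 - poissonMass t (Set.Ioi M) - (A.card : ℝ) / Fintype.card G
      ≤ tvDist (generators z) t := by
  classical
  refine le_trans ?_ (le_ciSup (f := fun x : G => (1 / 2 : ℝ) * ∑ y : G,
    |heatKernel (generators z) t x y - 1 / (Fintype.card G : ℝ)|)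
    (Set.finite_range _).bddAbove 1)
  have hG : (0 : ℝ) < Fintype.card G := by exact_mod_cast Fintype.card_pos
  set c : ℝ := 1 / (Fintype.card G : ℝ) with hc
  set h : G → ℝ := fun y => heatKernel (generators z) t 1 y with hh
  have hs : ∀ y, Summable fun j => poissonWeight t j * wordLaw z j y := fun y =>
    summable_poissonWeight_mul ht fun j => wordLaw_abs_le_one z hk j y
  have hy : ∀ y, h y = ∑' j, poissonWeight t j * wordLaw z j y := fun y => by
    simp [hh, heatKernel_generators]
  have htot : ∑ y, h y = 1 := by
    simp_rw [hy]
    rw [← Summable.tsum_finsetSum fun y _ => hs y]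
    simp_rw [← Finset.mul_sum, sum_wordLaw z hk, mul_one]
    exact (hasSum_poissonWeight t).tsum_eq
  have hcompl : ∑ y ∈ Aᶜ, h y ≤ poissonMass t (Set.Ioi M) := by
    simp_rw [hy]
    rw [← Summable.tsum_finsetSum fun y _ => hs y]
    refine Summable.tsum_le_tsum (fun j => ?_) (summable_sum fun y _ => hs y)
      ((hasSum_poissonWeight t).summable.indicator _)
    rw [← Finset.mul_sum]
    rcases le_or_gt j M with hj | hj
    · rw [Finset.sum_eq_zero fun g hg => hA j hj g (by simpa using hg), mul_zero]
      exact Set.indicator_nonneg (fun j _ => poissonWeight_nonneg ht j) j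
    · rw [Set.indicator_of_mem (Set.mem_Ioi.2 hj)]
      refine mul_le_of_le_one_right (poissonWeight_nonneg ht j) ?_
      rw [← sum_wordLaw z hk j]
      exact Finset.sum_le_sum_of_subset_of_nonneg (Finset.subset_univ _)
        fun g _ _ => wordLaw_nonneg z j g
  have hAc : ∑ y ∈ A, h y + ∑ y ∈ Aᶜ, h y = 1 := by rw [Finset.sum_add_sum_compl, htot]
  have hcc : ∑ y ∈ A, c + ∑ y ∈ Aᶜ, c = 1 := by
    rw [Finset.sum_add_sum_compl, Finset.sum_const, Finset.card_univ, nsmul_eq_mul, hc]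
    field_simp
  have hcA : ∑ y ∈ A, c = (A.card : ℝ) / Fintype.card G := by
    rw [Finset.sum_const, nsmul_eq_mul, hc, mul_one_div]
  have e1 : ∑ y ∈ A, h y - ∑ y ∈ A, c ≤ ∑ y ∈ A, |h y - c| := by
    rw [← Finset.sum_sub_distrib]
    exact Finset.sum_le_sum fun y _ => le_abs_self _
  have e2 : ∑ y ∈ Aᶜ, c - ∑ y ∈ Aᶜ, h y ≤ ∑ y ∈ Aᶜ, |h y - c| := by
    rw [← Finset.sum_sub_distrib]
    exact Finset.sum_le_sum fun y _ => by rw [abs_sub_comm]; exact le_abs_self _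
  have e3 := Finset.sum_add_sum_compl A fun y => |h y - c|
  change _ ≤ (1 / 2 : ℝ) * ∑ y : G, |h y - c|
  linarith

end HeatKernel

/-! ### The averaged return probability -/

section Average

variable {G : Type*} [Group G] {k : ℕ}

lemma letterVal_congr {z z' : Fin k → G} {a : Fin k × Bool} (h : z a.1 = z' a.1) :
    letterVal z a = letterVal z' a := by
  simp [letterVal, h]

lemma wordVal_congr {z z' : Fin k → G} {j : ℕ} {w : Fin j → Fin k × Bool}
    (h : ∀ m, z (w m).1 = z' (w m).1) : wordVal z w = wordVal z' w := by
  unfold wordVal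
  congr 2
  funext m
  exact letterVal_congr (h m)

/-- A generator that occurs exactly once in a word is determined by the value of the word and the
other generators. -/
lemma eq_of_wordVal_eq {z z' : Fin k → G} {i : Fin k} (hz : ∀ i', i' ≠ i → z i' = z' i')
    {j : ℕ} {w : Fin j → Fin k × Bool} (hi : ∃! m, (w m).1 = i)
    (hw : wordVal z w = wordVal z' w) : z i = z' i := by
  induction j with
  | zero => exact hi.exists.choose.elim0
  | succ j ih =>
    rw [wordVal_succ, wordVal_succ] at hw
    obtain ⟨m, hm, huniq⟩ := hi
    by_cases h0 : (w 0).1 = i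
    · have hm0 : 0 = m := huniq 0 h0
      have htail : wordVal z (fun m => w m.succ) = wordVal z' (fun m => w m.succ) := by
        refine wordVal_congr fun m' => hz _ fun h => ?_
        exact Fin.succ_ne_zero m' ((huniq _ h).trans hm0.symm)
      rw [htail] at hw
      have h := mul_right_cancel hw
      unfold letterVal at h
      rw [h0] at h
      split_ifs at h
      · exact h
      · exact inv_injective h
    · rw [letterVal_congr (hz _ h0)] at hw
      refine ih ?_ (mul_left_cancel hw)
      have hm0 : m ≠ 0 := fun h => h0 (h ▸ hm)
      obtain ⟨m', rfl⟩ := Fin.exists_succ_eq.2 hm0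
      exact ⟨m', hm, fun m'' h => Fin.succ_injective _ (huniq _ h)⟩

variable [Fintype G]

open Classical in
/-- If some generator occurs exactly once in the word `w`, then the value of `w` is uniform when
the generators are; only the upper bound for the probability of the value `1` is needed. -/
lemma card_wordVal_eq_one_mul_le {j : ℕ} {w : Fin j → Fin k × Bool} {i : Fin k}
    (hi : ∃! m, (w m).1 = i) :
    (Finset.univ.filter fun z : Fin k → G => wordVal z w = 1).card * Fintype.card G
      ≤ Fintype.card G ^ k := by
  have hcard : Fintype.card (Fin k → G) = Fintype.card G ^ k := by simp
  rw [← hcard, ← Finset.card_univ, ← Finset.card_univ, ← Finset.card_product]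
  refine Finset.card_le_card_of_injOn (fun p => Function.update p.1 i p.2)
    (fun _ _ => Finset.mem_coe.2 (Finset.mem_univ _)) ?_
  rintro ⟨z, g⟩ hz ⟨z', g'⟩ hz' h
  simp only [Finset.coe_product, Set.mem_prod, Finset.mem_coe, Finset.mem_filter,
    Finset.mem_univ, true_and, and_true] at hz hz'
  simp only at h
  have hg : g = g' := by simpa using congrFun h i
  have hoff : ∀ i', i' ≠ i → z i' = z' i' := fun i' hne => by
    simpa [Function.update_of_ne hne] using congrFun h i'
  have hzi := eq_of_wordVal_eq hoff hi (hz.trans hz'.symm)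
  have : z = z' := by
    funext i'
    by_cases hne : i' = i
    · rw [hne, hzi]
    · exact hoff i' hne
  rw [this, hg]

open Classical in
/-- In a word of length `2 * M` without a generator that occurs exactly once, at most `M`
generators occur. -/
lemma card_words_no_single_le {M : ℕ} (hM : M ≤ k) :
    (Finset.univ.filter fun w : Fin (2 * M) → Fin k × Bool =>
      ∀ i, ¬ ∃! m, (w m).1 = i).card ≤ k.choose M * (2 * M) ^ (2 * M) := by
  have hsub : (Finset.univ.filter fun w : Fin (2 * M) → Fin k × Bool =>
      ∀ i, ¬ ∃! m, (w m).1 = i) ⊆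
      (Finset.powersetCard M (Finset.univ : Finset (Fin k))).biUnion
        fun s => Fintype.piFinset fun _ => s ×ˢ (Finset.univ : Finset Bool) := by
    intro w hw
    rw [Finset.mem_filter] at hw
    have hcard : (Finset.univ.image fun m => (w m).1).card ≤ M := by
      have h1 := Finset.card_eq_sum_card_image (fun m => (w m).1)
        (Finset.univ : Finset (Fin (2 * M)))
      have h2 := Finset.card_nsmul_le_sum (Finset.univ.image fun m => (w m).1)
        (fun b => (Finset.univ.filter fun a => (w a).1 = b).card) 2 (fun b hb => ?_)
      · rw [← h1] at h2
        simp at h2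
        omega
      -- A generator that occurs does so at least twice.
      · obtain ⟨m, -, hm⟩ := Finset.mem_image.1 hb
        by_contra hlt
        refine hw.2 b ⟨m, hm, fun m' hm' => ?_⟩
        have : (Finset.univ.filter fun a => (w a).1 = b).card ≤ 1 := by omega
        exact Finset.card_le_one.1 this _ (by simpa using hm') _ (by simpa using hm)
    obtain ⟨s, hs, hsM⟩ := Finset.exists_superset_card_eq hcard (by simpa using hM)
    rw [Finset.mem_biUnion]
    refine ⟨s, Finset.mem_powersetCard.2 ⟨Finset.subset_univ _, hsM⟩, ?_⟩
    rw [Fintype.mem_piFinset]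
    intro m
    exact Finset.mem_product.2 ⟨hs (Finset.mem_image_of_mem _ (Finset.mem_univ m)),
      Finset.mem_univ _⟩
  refine (Finset.card_le_card hsub).trans (Finset.card_biUnion_le.trans (le_of_eq ?_))
  rw [Finset.sum_congr rfl (g := fun _ => (2 * M) ^ (2 * M)) fun s hs => ?_]
  · simp
  · rw [Fintype.card_piFinset]
    simp [(Finset.mem_powersetCard.1 hs).2, mul_comm]

lemma choose_le_exp_mul_div_pow (n : ℕ) {M : ℕ} (hM : 0 < M) :
    (n.choose M : ℝ) ≤ (Real.exp 1 * n / M) ^ M := by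
  have hM' : (0 : ℝ) < M := by exact_mod_cast hM
  have hf : (0 : ℝ) < M.factorial := by exact_mod_cast M.factorial_pos
  have h1 := Real.pow_div_factorial_le_exp (M : ℝ) hM'.le M
  rw [div_le_iff₀ hf, ← mul_one (M : ℝ), Real.exp_nat_mul, mul_one] at h1
  refine (Nat.choose_le_pow_div M n).trans ?_
  rw [div_pow, mul_pow, div_le_div_iff₀ hf (by positivity)]
  calc (n : ℝ) ^ M * (M : ℝ) ^ M ≤ (n : ℝ) ^ M * (Real.exp 1 ^ M * M.factorial) := by gcongr
    _ = _ := by ring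

/-- The return probability after `2 * M` steps, summed over all choices of the generators: the
words without a generator that occurs exactly once contribute the second term. -/
lemma average_return_le {M : ℕ} (hM0 : 0 < M) (hM : M ≤ k) :
    ∑ z : Fin k → G, wordLaw z (2 * M) 1
      ≤ (Fintype.card G : ℝ) ^ k
        * (1 / Fintype.card G + (Real.exp 1 * M / k) ^ M) := by
  classical
  have hk : 0 < k := hM0.trans_le hM
  have hk' : (0 : ℝ) < k := by exact_mod_cast hk
  have hM' : (0 : ℝ) < M := by exact_mod_cast hM0
  have hG : (0 : ℝ) < Fintype.card G := by exact_mod_cast Fintype.card_pos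
  set B := Finset.univ.filter fun w : Fin (2 * M) → Fin k × Bool =>
      ∀ i, ¬ ∃! m, (w m).1 = i with hB
  have hBcard : (B.card : ℝ) ≤ (k.choose M : ℝ) * (2 * M) ^ (2 * M) := by
    exact_mod_cast card_words_no_single_le hM
  have hgood : ∀ w : Fin (2 * M) → Fin k × Bool,
      ((Finset.univ.filter fun z : Fin k → G => wordVal z w = 1).card : ℝ)
        ≤ (Fintype.card G : ℝ) ^ k * (1 / Fintype.card G)
          + (Fintype.card G : ℝ) ^ k * (if w ∈ B then 1 else 0) := by
    intro w
    by_cases hw : w ∈ B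
    · rw [if_pos hw, mul_one]
      refine le_add_of_nonneg_of_le (by positivity) ?_
      have : Fintype.card (Fin k → G) = Fintype.card G ^ k := by simp
      exact_mod_cast (Finset.card_le_univ _).trans this.le
    · rw [if_neg hw, mul_zero, add_zero]
      simp only [hB, Finset.mem_filter, Finset.mem_univ, true_and, not_forall, not_not] at hw
      obtain ⟨i, hi⟩ := hw
      rw [mul_one_div, le_div_iff₀ hG]
      exact_mod_cast card_wordVal_eq_one_mul_le (G := G) hi
  have hcardw : (Fintype.card (Fin (2 * M) → Fin k × Bool) : ℝ) = (2 * k) ^ (2 * M) := by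
    simp [mul_comm]
  calc ∑ z : Fin k → G, wordLaw z (2 * M) 1
      = (∑ w : Fin (2 * M) → Fin k × Bool,
          ((Finset.univ.filter fun z : Fin k → G => wordVal z w = 1).card : ℝ))
          / (2 * k : ℝ) ^ (2 * M) := by
        simp only [wordLaw]
        rw [← Finset.sum_div, Finset.sum_comm]
        simp only [Finset.sum_boole]
    _ ≤ (∑ w : Fin (2 * M) → Fin k × Bool,
          ((Fintype.card G : ℝ) ^ k * (1 / Fintype.card G)
          + (Fintype.card G : ℝ) ^ k * (if w ∈ B then 1 else 0))) / (2 * k : ℝ) ^ (2 * M) := by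
        gcongr with w _
        exact hgood w
    _ = (Fintype.card G : ℝ) ^ k
          * (1 / Fintype.card G + B.card / (2 * k : ℝ) ^ (2 * M)) := by
        rw [Finset.sum_add_distrib, Finset.sum_const, Finset.card_univ, nsmul_eq_mul, hcardw,
          ← Finset.mul_sum, Finset.sum_boole, Finset.filter_univ_mem]
        field_simp
    _ ≤ _ := by
        gcongr
        calc (B.card : ℝ) / (2 * k : ℝ) ^ (2 * M)
            ≤ (Real.exp 1 * k / M) ^ M * (2 * M) ^ (2 * M) / (2 * k : ℝ) ^ (2 * M) := by
              gcongr
              exact hBcard.trans (by gcongr; exact choose_le_exp_mul_div_pow k hM0)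
          _ = (Real.exp 1 * M / k) ^ M := by
              rw [pow_mul, pow_mul, ← mul_pow, ← div_pow]
              congr 1
              field_simp

/-- The expected distance to uniformity after `M` steps. -/
lemma average_wordDist_le {M : ℕ} (hM0 : 0 < M) (hM : M ≤ k) :
    ∑ z : Fin k → G, wordDist z M
      ≤ (Fintype.card G : ℝ) ^ k
        * √(Fintype.card G * (Real.exp 1 * M / k) ^ M) := by
  have hk : 0 < k := hM0.trans_le hM
  have hG : (0 : ℝ) < Fintype.card G := by exact_mod_cast Fintype.card_pos
  have hcard : (((Finset.univ : Finset (Fin k → G)).card : ℕ) : ℝ)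
      = (Fintype.card G : ℝ) ^ k := by simp
  set Q : ℝ := (Fintype.card G : ℝ) ^ k with hQ
  have hQ0 : 0 < Q := by positivity
  have h2 : ∑ z : Fin k → G, wordDist z M ^ 2
      ≤ Q * (Fintype.card G * (Real.exp 1 * M / k) ^ M) := by
    calc ∑ z : Fin k → G, wordDist z M ^ 2
        ≤ ∑ z : Fin k → G, (Fintype.card G * wordLaw z (2 * M) 1 - 1) :=
          Finset.sum_le_sum fun z _ => wordDist_sq_le z hk M
      _ = Fintype.card G * ∑ z : Fin k → G, wordLaw z (2 * M) 1 - Q := by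
          rw [Finset.sum_sub_distrib, ← Finset.mul_sum, Finset.sum_const, nsmul_eq_mul, hcard,
            mul_one]
      _ ≤ Fintype.card G * (Q * (1 / Fintype.card G + (Real.exp 1 * M / k) ^ M)) - Q := by
          gcongr
          exact average_return_le hM0 hM
      _ = _ := by field_simp; ring
  have h1 := sq_sum_le_card_mul_sum_sq (s := (Finset.univ : Finset (Fin k → G)))
    (f := fun z => wordDist z M)
  rw [hcard] at h1
  have h3 : (∑ z : Fin k → G, wordDist z M) ^ 2
      ≤ Q ^ 2 * (Fintype.card G * (Real.exp 1 * M / k) ^ M) := by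
    refine h1.trans ?_
    rw [sq Q, mul_assoc]
    exact mul_le_mul_of_nonneg_left h2 hQ0.le
  calc ∑ z : Fin k → G, wordDist z M
      ≤ √(Q ^ 2 * (Fintype.card G * (Real.exp 1 * M / k) ^ M)) := Real.le_sqrt_of_sq_le h3
    _ = _ := by rw [Real.sqrt_mul (by positivity), Real.sqrt_sq hQ0.le]

end Average

/-! ### Counting the elements spelled by short words in a virtually abelian group -/

section Support

open scoped IsMulCommutative

variable {G : Type*} [Group G] {k : ℕ}

/-- The factor contributed to a word by the letter `a` read when the prefix lies in the coset `c`: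
the Schreier generator `rep c * a * (rep (c * a))⁻¹` of `H`. -/
noncomputable def schreierFactor (H : Subgroup G) [H.Normal] (z : Fin k → G)
    (p : (G ⧸ H) × (Fin k × Bool)) : H :=
  ⟨p.1.out * letterVal z p.2 * (p.1 * ((letterVal z p.2 : G) : G ⧸ H)).out⁻¹, by
    rw [← QuotientGroup.eq_one_iff]
    simp⟩

/-- A word is the product of the Schreier factors of its letters and a coset representative.
As `H` is commutative, only the multiset of pairs (coset, letter) matters. -/
lemma exists_sym_out_mul_wordVal (H : Subgroup G) [H.Normal] [IsMulCommutative H]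
    (z : Fin k → G) {j : ℕ} (w : Fin j → Fin k × Bool) (c : G ⧸ H) :
    ∃ (m : Sym ((G ⧸ H) × (Fin k × Bool)) j) (d : G ⧸ H),
      c.out * wordVal z w = ((m : Multiset _).map (schreierFactor H z)).prod * d.out := by
  induction j generalizing c with
  | zero => exact ⟨Sym.nil, c, by simp⟩
  | succ j ih =>
    obtain ⟨m, d, h⟩ := ih (fun i => w i.succ) (c * ((letterVal z (w 0) : G) : G ⧸ H))
    refine ⟨(c, w 0) ::ₛ m, d, ?_⟩
    rw [wordVal_succ, Sym.coe_cons, Multiset.map_cons, Multiset.prod_cons, Subgroup.coe_mul,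
      mul_assoc (schreierFactor H z (c, w 0) : G), ← h]
    simp [schreierFactor, mul_assoc]

open Classical in
/-- The elements spelled by words of length at most `M`. -/
noncomputable def reach [Fintype G] (z : Fin k → G) (M : ℕ) : Finset G :=
  Finset.univ.filter fun g => ∃ j ≤ M, ∃ w : Fin j → Fin k × Bool, wordVal z w = g

variable [Fintype G]

lemma wordLaw_eq_zero_of_notMem_reach (z : Fin k → G) {M j : ℕ} (hj : j ≤ M) {g : G}
    (hg : g ∉ reach z M) : wordLaw z j g = 0 := by
  classical
  unfold wordLaw
  rw [Finset.sum_eq_zero, zero_div]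
  intro w _
  rw [if_neg]
  intro h
  exact hg (by simpa [reach] using ⟨j, hj, w, h⟩)

lemma card_reach_le (H : Subgroup G) [H.Normal] [IsMulCommutative H] (z : Fin k → G) (M : ℕ) :
    (reach z M).card ≤ H.index * (M + H.index * (2 * k)).choose M := by
  classical
  have hidx : Fintype.card (G ⧸ H) = H.index := by
    rw [Subgroup.index, Nat.card_eq_fintype_card]
  have hsub : reach z M ⊆ (Finset.range (M + 1)).biUnion fun j =>
      (Finset.univ : Finset (Sym ((G ⧸ H) × (Fin k × Bool)) j × (G ⧸ H))).image fun p =>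
        ((1 : G ⧸ H).out)⁻¹ *
          ((((p.1 : Multiset _).map (schreierFactor H z)).prod : G) * p.2.out) := by
    intro g hg
    obtain ⟨-, j, hj, w, hw⟩ := Finset.mem_filter.1 hg
    obtain ⟨m, d, h⟩ := exists_sym_out_mul_wordVal H z w 1
    rw [Finset.mem_biUnion]
    refine ⟨j, Finset.mem_range.2 (Nat.lt_succ_of_le hj), ?_⟩
    rw [Finset.mem_image]
    exact ⟨(m, d), Finset.mem_univ _, by rw [← h, hw]; simp⟩
  calc (reach z M).card
      ≤ ∑ j ∈ Finset.range (M + 1),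
          Fintype.card (Sym ((G ⧸ H) × (Fin k × Bool)) j × (G ⧸ H)) :=
        (Finset.card_le_card hsub).trans (Finset.card_biUnion_le.trans
          (Finset.sum_le_sum fun j _ => Finset.card_image_le))
    _ = ∑ j ∈ Finset.range (M + 1), (H.index * (2 * k)).multichoose j * H.index := by
        refine Finset.sum_congr rfl fun j _ => ?_
        rw [Fintype.card_prod, Sym.card_sym_eq_multichoose, Fintype.card_prod,
          Fintype.card_prod, hidx]
        simp [mul_comm k 2]
    _ = _ := by
        rw [← Finset.sum_mul, Nat.sum_range_multichoose, mul_comm, Nat.choose_symm_add]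

/-- Exponential form of `card_reach_le`, with the index bounded by `B`. -/
lemma card_reach_le_pow (H : Subgroup G) [H.Normal] [IsMulCommutative H] (z : Fin k → G)
    {M B : ℕ} (hM0 : 0 < M) (hM : M ≤ k) (hB : H.index ≤ B) :
    ((reach z M).card : ℝ) ≤ B * (Real.exp 1 * (3 * B) * (k / M)) ^ M := by
  have hB1 : 1 ≤ B := (Nat.one_le_iff_ne_zero.2 Subgroup.index_ne_zero_of_finite).trans hB
  have h1 : (reach z M).card ≤ B * (3 * B * k).choose M := by
    refine (card_reach_le H z M).trans (Nat.mul_le_mul hB (Nat.choose_le_choose M ?_))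
    nlinarith [Nat.mul_le_mul_right (2 * k) hB, Nat.mul_le_mul_right k hB1]
  have h2 := choose_le_exp_mul_div_pow (3 * B * k) hM0
  calc ((reach z M).card : ℝ) ≤ B * ((3 * B * k).choose M : ℝ) := by exact_mod_cast h1
    _ ≤ B * (Real.exp 1 * (3 * B * k : ℕ) / M) ^ M := by gcongr
    _ = _ := by push_cast; ring

end Support

/-! ### Independent uniform generators -/

section Uniform

variable {G : Type*} [Group G] [Fintype G] [MeasurableSpace G] [DiscreteMeasurableSpace G] {k : ℕ}
  {Ω : Type*} [MeasurableSpace Ω] {μ : Measure Ω} {Z : Fin k → Ω → G}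

lemma measure_eq_of_uniform (hmeas : ∀ i, Measurable (Z i)) (hindep : iIndepFun Z μ)
    (hunif : ∀ i, μ.map (Z i) = uniformOn (Set.univ : Set G)) (z : Fin k → G) :
    μ {ω | (fun i => Z i ω) = z} = ENNReal.ofReal (((Fintype.card G : ℝ) ^ k)⁻¹) := by
  have hset : {ω | (fun i => Z i ω) = z} = ⋂ i ∈ (Finset.univ : Finset (Fin k)), Z i ⁻¹' {z i} := by
    ext ω
    simp [funext_iff]
  have hG : (0 : ℝ) < Fintype.card G := by exact_mod_cast Fintype.card_pos
  have h1 : ∀ i, μ (Z i ⁻¹' {z i}) = ENNReal.ofReal ((Fintype.card G : ℝ)⁻¹) := by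
    intro i
    rw [← Measure.map_apply (hmeas i) (measurableSet_singleton _), hunif, uniformOn_univ,
      Measure.count_singleton, ENNReal.ofReal_inv_of_pos hG, ENNReal.ofReal_natCast, one_div]
  rw [hset, hindep.measure_inter_preimage_eq_mul Finset.univ
    (sets := fun i => {z i}) (fun i _ => measurableSet_singleton _)]
  simp_rw [h1]
  rw [Finset.prod_const, Finset.card_univ, Fintype.card_fin, ← ENNReal.ofReal_pow (by positivity),
    inv_pow]

/-- Markov's inequality for a function of independent uniform generators. -/
lemma one_sub_le_measure_of_uniform [IsProbabilityMeasure μ] (hmeas : ∀ i, Measurable (Z i))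
    (hindep : iIndepFun Z μ) (hunif : ∀ i, μ.map (Z i) = uniformOn (Set.univ : Set G))
    {F : (Fin k → G) → ℝ} (hF : ∀ z, 0 ≤ F z) {b δ : ℝ} (hδ : 0 < δ)
    (hb : ∑ z, F z ≤ (Fintype.card G : ℝ) ^ k * b) :
    1 - ENNReal.ofReal (b / δ) ≤ μ {ω | F (fun i => Z i ω) ≤ δ} := by
  classical
  have hG : (0 : ℝ) < Fintype.card G := by exact_mod_cast Fintype.card_pos
  set S := Finset.univ.filter fun z => δ < F z with hS
  have hcard : (S.card : ℝ) * ((Fintype.card G : ℝ) ^ k)⁻¹ ≤ b / δ := by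
    have h1 : (S.card : ℝ) * δ ≤ ∑ z, F z := by
      rw [← nsmul_eq_mul]
      exact (Finset.card_nsmul_le_sum S F δ fun z hz => (Finset.mem_filter.1 hz).2.le).trans
        (Finset.sum_le_sum_of_subset_of_nonneg (Finset.subset_univ _) fun z _ _ => hF z)
    rw [← div_eq_mul_inv, div_le_div_iff₀ (by positivity) hδ]
    linarith
  have hbad : μ {ω | F (fun i => Z i ω) ≤ δ}ᶜ ≤ ENNReal.ofReal (b / δ) := by
    have hsub : {ω | F (fun i => Z i ω) ≤ δ}ᶜ ⊆ ⋃ z ∈ S, {ω | (fun i => Z i ω) = z} := by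
      intro ω hω
      simpa [hS] using hω
    refine (measure_mono hsub).trans ((measure_biUnion_finset_le S _).trans ?_)
    simp_rw [measure_eq_of_uniform hmeas hindep hunif]
    rw [Finset.sum_const, nsmul_eq_mul, ← ENNReal.ofReal_natCast,
      ← ENNReal.ofReal_mul (by positivity)]
    exact ENNReal.ofReal_le_ofReal hcard
  rw [tsub_le_iff_right]
  calc (1 : ENNReal) = μ Set.univ := measure_univ.symm
    _ ≤ _ := measure_univ_le_add_compl _
    _ ≤ _ := by gcongr

end Uniform

/-! ### Asymptotics of the cutoff time -/

section Asymptotics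

lemma tendsto_div_atTop_of_isLittleO {N κ : ℕ → ℝ} (hN : Tendsto N atTop atTop)
    (h : N =o[atTop] κ) (hκ : ∀ᶠ n in atTop, 0 < κ n) :
    Tendsto (fun n => κ n / N n) atTop atTop := by
  have h0 : Tendsto (fun n => N n / κ n) atTop (𝓝[>] 0) := by
    refine tendsto_nhdsWithin_iff.2 ⟨h.tendsto_div_nhds_zero, ?_⟩
    filter_upwards [hN.eventually_gt_atTop 0, hκ] with n h1 h2
    exact div_pos h1 h2
  refine h0.inv_tendsto_nhdsGT_zero.congr fun n => ?_
  simp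

/-- The cutoff time tends to infinity: this is where `log k = o(log |G|)` is needed, so that the
Poisson number of steps concentrates. -/
lemma tendsto_cutoff_time {N κ : ℕ → ℝ} (hN : Tendsto N atTop atTop)
    (hL : Tendsto (fun n => Real.log (κ n / N n)) atTop atTop) (hκ : ∀ᶠ n in atTop, 0 < κ n)
    (hsmall : (fun n => Real.log (κ n)) =o[atTop] N) :
    Tendsto (fun n => N n / Real.log (κ n / N n)) atTop atTop := by
  refine tendsto_div_atTop_of_isLittleO hL ?_ (hN.eventually_gt_atTop 0)
  refine IsBigO.trans_isLittleO ?_ hsmall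
  refine IsBigO.of_bound 1 ?_
  filter_upwards [hN.eventually_ge_atTop 1, hL.eventually_ge_atTop 0, hκ] with n h1 h2 h3
  have h4 : Real.log (κ n / N n) ≤ Real.log (κ n) :=
    Real.log_le_log (by positivity) (div_le_self h3.le h1)
  rw [Real.norm_of_nonneg h2, Real.norm_of_nonneg (h2.trans h4), one_mul]
  exact h4

/-- With `N = log |G|`, `κ = k` and `M` between `(1 + ε / 2) * t₀` and `(1 + ε) * t₀`, the order of
the group times the probability that no generator occurs exactly once in `2 * M` letters is
small. The gain of `log L` in `log (κ / M)` over `log (κ / N)` absorbs all constants. -/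
lemma exp_mul_pow_le {N κ L ε : ℝ} {M : ℕ} (hN : 0 < N) (hκ : 0 < κ) (hε : 0 < ε)
    (hL : L = Real.log (κ / N)) (hL0 : 0 < L) (hL1 : 1 + Real.log (1 + ε) ≤ Real.log L)
    (hM1 : (1 + ε / 2) * (N / L) ≤ M) (hM2 : M ≤ (1 + ε) * (N / L)) :
    Real.exp N * (Real.exp 1 * M / κ) ^ M ≤ Real.exp (-(ε / 2 * N)) := by
  have hbase : Real.exp 1 * M / κ ≤ Real.exp (-L) := by
    calc Real.exp 1 * M / κ ≤ Real.exp 1 * ((1 + ε) * (N / L)) / κ := by gcongr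
      _ = Real.exp (1 + Real.log (1 + ε) - Real.log L - L) := by
        rw [Real.exp_sub, Real.exp_sub, Real.exp_add, Real.exp_log (by positivity),
          Real.exp_log hL0]
        conv_rhs => rw [hL, Real.exp_log (by positivity)]
        rw [← hL]
        field_simp
      _ ≤ Real.exp (-L) := Real.exp_le_exp.2 (by linarith)
  calc Real.exp N * (Real.exp 1 * M / κ) ^ M ≤ Real.exp N * Real.exp (-L) ^ M := by gcongr
    _ = Real.exp (N - M * L) := by
      rw [← Real.exp_nat_mul, ← Real.exp_add]
      ring_nf
    _ ≤ _ := by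
      refine Real.exp_le_exp.2 ?_
      have h := mul_le_mul_of_nonneg_right hM1 hL0.le
      rw [mul_assoc, div_mul_cancel₀ _ hL0.ne'] at h
      linarith

/-- With `N = log |G|`, `κ = k` and `M` between `(1 - ε) * t₀` and `(1 - ε / 2) * t₀`, the number
of elements spelled by words of length at most `M` is at most `|G| ^ (1 - ε / 4)`, up to a constant
factor. -/
lemma pow_le_exp {N κ L ε D : ℝ} {M : ℕ} (hN : 0 < N) (hκ : 0 < κ) (hε : 0 < ε) (hε1 : ε < 1)
    (hD : 0 < D) (hL : L = Real.log (κ / N)) (hL0 : 0 < L)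
    (hL1 : Real.log L + Real.log (D / (1 - ε)) ≤ ε / 4 * L)
    (hM1 : (1 - ε) * (N / L) ≤ M) (hM2 : M ≤ (1 - ε / 2) * (N / L)) :
    (D * (κ / M)) ^ M ≤ Real.exp ((1 - ε / 4) * N) := by
  have hε' : 0 < 1 - ε := by linarith
  have hbase : D * (κ / M) ≤ Real.exp ((1 + ε / 4) * L) := by
    calc D * (κ / M) ≤ D * (κ / ((1 - ε) * (N / L))) := by gcongr
      _ = Real.exp (Real.log L + Real.log (D / (1 - ε)) + L) := by
        rw [Real.exp_add, Real.exp_add, Real.exp_log hL0, Real.exp_log (div_pos hD hε')]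
        conv_rhs => rw [hL, Real.exp_log (by positivity)]
        rw [← hL]
        field_simp
      _ ≤ _ := Real.exp_le_exp.2 (by linarith)
  calc (D * (κ / M)) ^ M ≤ Real.exp ((1 + ε / 4) * L) ^ M := by gcongr
    _ = Real.exp ((1 + ε / 4) * (M * L)) := by
      rw [← Real.exp_nat_mul]
      ring_nf
    _ ≤ _ := by
      -- `(1 + ε / 4) * (1 - ε / 2) = 1 - ε / 4 - ε ^ 2 / 8`
      refine Real.exp_le_exp.2 ?_
      have h := mul_le_mul_of_nonneg_right hM2 hL0.le
      rw [mul_assoc, div_mul_cancel₀ _ hL0.ne'] at h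
      nlinarith [mul_le_mul_of_nonneg_left h (by positivity : 0 ≤ 1 + ε / 4),
        mul_nonneg (sq_nonneg ε) hN.le]

end Asymptotics

/-! ### The two halves of the cutoff -/

section Cutoff

lemma tvDist_nonneg {G : Type*} [Group G] [Fintype G] (S : Multiset G) (t : ℝ) :
    0 ≤ tvDist S t :=
  Real.iSup_nonneg fun _ => by positivity

/-- In a virtually abelian group, for every choice of the generators the walk is far from
uniform while it has made few steps. -/
lemma eventually_le_tvDist {G : ℕ → Type*} [∀ n, Group (G n)] [∀ n, Fintype (G n)]
    (H : ∀ n, Subgroup (G n)) (hnormal : ∀ n, (H n).Normal)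
    (habelian : ∀ n, ∀ a ∈ H n, ∀ b ∈ H n, a * b = b * a)
    {B : ℕ} (hB : ∀ n, (H n).index ≤ B) {k : ℕ → ℕ}
    {N L : ℕ → ℝ} (hNdef : ∀ n, N n = Real.log (Fintype.card (G n)))
    (hLdef : ∀ n, L n = Real.log ((k n : ℝ) / N n))
    (hN : Tendsto N atTop atTop) (hL : Tendsto L atTop atTop)
    (ht : Tendsto (fun n => N n / L n) atTop atTop) (hNk : ∀ᶠ n in atTop, N n ≤ k n)
    {ε δ : ℝ} (hε : 0 < ε) (hε1 : ε < 1) (hδ : 0 < δ) :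
    ∀ᶠ n in atTop, ∀ z : Fin (k n) → G n,
      1 - δ ≤ tvDist (generators z) ((1 - ε) * (N n / L n)) := by
  have hε' : 0 < 1 - ε := by linarith
  have hB1 : 0 < B := (Nat.pos_of_ne_zero Subgroup.index_ne_zero_of_finite).trans_le (hB 0)
  have hB1' : (0 : ℝ) < B := by exact_mod_cast hB1
  -- More than `(1 - ε / 2) * t₀` steps at time `(1 - ε) * t₀` means at least `a` times the mean.
  set a : ℝ := (1 - ε / 2) / (1 - ε) with ha
  have ha1 : 1 < a := by rw [ha, one_lt_div hε']; linarith
  have hr := poisson_rate_pos (zero_lt_one.trans ha1) ha1.ne'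
  set r : ℝ := 1 - a + a * Real.log a
  set D : ℝ := Real.exp 1 * (3 * B)
  have hD0 : 0 < D := by positivity
  have hlog : ∀ᶠ n in atTop,
      Real.log (L n) + Real.log (D / (1 - ε)) ≤ ε / 4 * L n := by
    have h1 : (fun n => Real.log (L n) + Real.log (D / (1 - ε))) =o[atTop] L :=
      (Real.isLittleO_log_id_atTop.comp_tendsto hL).add
        ((isLittleO_const_left (E'' := ℝ)).2 (Or.inr (tendsto_norm_atTop_atTop.comp hL)))
    filter_upwards [h1.bound (by positivity : 0 < ε / 4), hL.eventually_ge_atTop 0] with n h2 h3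
    rw [Real.norm_of_nonneg h3] at h2
    exact (le_abs_self _).trans h2
  have hsmall : Tendsto (fun n => Real.exp (-((1 - ε) * (N n / L n) * r))
      + B * Real.exp (-(ε / 4 * N n))) atTop (𝓝 0) := by
    have h1 : Tendsto (fun n => Real.exp (-((1 - ε) * (N n / L n) * r))) atTop (𝓝 0) :=
      Real.tendsto_exp_neg_atTop_nhds_zero.comp
        ((ht.const_mul_atTop hε').atTop_mul_const hr)
    have h2 : Tendsto (fun n => Real.exp (-(ε / 4 * N n))) atTop (𝓝 0) :=
      Real.tendsto_exp_neg_atTop_nhds_zero.comp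
        (hN.const_mul_atTop (by positivity : 0 < ε / 4))
    simpa using h1.add (h2.const_mul (B : ℝ))
  filter_upwards [hlog, hsmall.eventually_le_const hδ, hN.eventually_gt_atTop 0,
    hL.eventually_ge_atTop 1, ht.eventually_ge_atTop (2 / ε), hNk]
    with n hlog hsmall hN hL ht hNk z
  have hL0 : 0 < L n := by linarith
  have ht0 : 0 < N n / L n := by positivity
  -- This makes room for an integer between the two multiples of `t₀` that bracket `M` below.
  have hεt : 1 ≤ ε / 2 * (N n / L n) := by
    rw [div_le_iff₀ hε] at ht
    linarith
  set t₀ := N n / L n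
  have htN : t₀ ≤ N n := div_le_self hN.le hL
  set M := ⌊(1 - ε / 2) * t₀⌋₊ with hM
  have hx : 0 ≤ (1 - ε / 2) * t₀ := mul_nonneg (by linarith) ht0.le
  have hM2 : (M : ℝ) ≤ (1 - ε / 2) * t₀ := Nat.floor_le hx
  have hM1 : (1 - ε) * t₀ ≤ M := by
    have := Nat.lt_floor_add_one ((1 - ε / 2) * t₀)
    linarith
  have hM0 : 0 < M := by
    have : (0 : ℝ) < M := (mul_pos hε' ht0).trans_le hM1
    exact_mod_cast this
  have hMk : M ≤ k n := by
    have : (M : ℝ) ≤ k n := by nlinarith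
    exact_mod_cast this
  have hk : 0 < k n := hM0.trans_le hMk
  have hκ : (0 : ℝ) < k n := by exact_mod_cast hk
  have := hnormal n
  have : IsMulCommutative (H n) :=
    ⟨⟨fun a b => Subtype.ext (habelian n a a.2 b b.2)⟩⟩
  have hcard : (0 : ℝ) < Fintype.card (G n) := by exact_mod_cast Fintype.card_pos
  have hreach : ((reach z M).card : ℝ) / Fintype.card (G n) ≤ B * Real.exp (-(ε / 4 * N n)) := by
    have h1 := (card_reach_le_pow (H n) z hM0 hMk (hB n)).trans
      (mul_le_mul_of_nonneg_left
        (pow_le_exp hN hκ hε hε1 hD0 (hLdef n) hL0 hlog hM1 hM2) hB1'.le)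
    have h2 : (Fintype.card (G n) : ℝ) = Real.exp (N n) := by
      rw [hNdef, Real.exp_log hcard]
    rw [h2, div_le_iff₀ (Real.exp_pos _), mul_assoc, ← Real.exp_add]
    refine h1.trans (le_of_eq ?_)
    ring_nf
  have htail : poissonMass ((1 - ε) * t₀) (Set.Ioi M)
      ≤ Real.exp (-((1 - ε) * t₀ * r)) := by
    refine poissonMass_le (by positivity) (zero_lt_one.trans ha1) fun j hj => ?_
    have hj' := (Nat.floor_lt hx).1 (Set.mem_Ioi.1 hj)
    refine mul_le_mul_of_nonneg_right ?_ (Real.log_nonneg ha1.le)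
    rw [ha, ← mul_assoc, div_mul_cancel₀ _ hε'.ne']
    exact hj'.le
  have := le_tvDist z hk (by positivity : 0 ≤ (1 - ε) * t₀) M (reach z M)
    fun j hj g hg => wordLaw_eq_zero_of_notMem_reach z hj hg
  linarith

/-- In every group, for most choices of the generators the walk is close to uniform once it has
made enough steps. -/
lemma tendsto_measure_tvDist_le {G : ℕ → Type*} [∀ n, Group (G n)] [∀ n, Fintype (G n)]
    [∀ n, MeasurableSpace (G n)] [∀ n, DiscreteMeasurableSpace (G n)] {k : ℕ → ℕ}
    {Ω : ℕ → Type*} [∀ n, MeasurableSpace (Ω n)]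
    (μ : ∀ n, Measure (Ω n)) [∀ n, IsProbabilityMeasure (μ n)]
    {Z : ∀ n, Fin (k n) → Ω n → G n}
    (hZ_meas : ∀ n i, Measurable (Z n i))
    (hZ_indep : ∀ n, iIndepFun (Z n) (μ n))
    (hZ_unif : ∀ n i, (μ n).map (Z n i) = uniformOn (Set.univ : Set (G n)))
    {N L : ℕ → ℝ} (hNdef : ∀ n, N n = Real.log (Fintype.card (G n)))
    (hLdef : ∀ n, L n = Real.log ((k n : ℝ) / N n))
    (hN : Tendsto N atTop atTop) (hL : Tendsto L atTop atTop)
    (ht : Tendsto (fun n => N n / L n) atTop atTop) (hNk : ∀ᶠ n in atTop, N n ≤ k n)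
    {ε δ : ℝ} (hε : 0 < ε) (hδ : 0 < δ) :
    Tendsto (fun n => μ n {ω | tvDist (generators fun i => Z n i ω) ((1 + ε) * (N n / L n)) ≤ δ})
      atTop (𝓝 1) := by
  have hε' : 0 < 1 + ε := by linarith
  -- Less than `(1 + ε / 2) * t₀` steps at time `(1 + ε) * t₀` means at most `a` times the mean.
  set a : ℝ := (1 + ε / 2) / (1 + ε) with ha
  have ha0 : 0 < a := by positivity
  have ha1 : a < 1 := by rw [ha, div_lt_one hε']; linarith
  have hr := poisson_rate_pos ha0 ha1.ne
  set r : ℝ := 1 - a + a * Real.log a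
  set b : ℕ → ℝ := fun n => Real.exp (-((1 + ε) * (N n / L n) * r))
      + √(Real.exp (-(ε / 2 * N n))) / 2 with hb
  have hb0 : Tendsto b atTop (𝓝 0) := by
    have h1 : Tendsto (fun n => Real.exp (-((1 + ε) * (N n / L n) * r))) atTop (𝓝 0) :=
      Real.tendsto_exp_neg_atTop_nhds_zero.comp
        ((ht.const_mul_atTop hε').atTop_mul_const hr)
    have h2 : Tendsto (fun n => Real.exp (-(ε / 2 * N n))) atTop (𝓝 0) :=
      Real.tendsto_exp_neg_atTop_nhds_zero.comp
        (hN.const_mul_atTop (by positivity : 0 < ε / 2))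
    simpa using h1.add (h2.sqrt.div_const 2)
  have hlim : Tendsto (fun n => 1 - ENNReal.ofReal (b n / δ)) atTop (𝓝 1) := by
    have h := ENNReal.tendsto_ofReal (hb0.div_const δ)
    simpa using ENNReal.Tendsto.sub tendsto_const_nhds h (Or.inl ENNReal.one_ne_top)
  -- `b n` bounds the expected distance, so Markov's inequality gives the lower bound.
  refine tendsto_of_tendsto_of_tendsto_of_le_of_le' hlim tendsto_const_nhds ?_
    (Eventually.of_forall fun n => prob_le_one)
  filter_upwards [(Real.tendsto_log_atTop.comp hL).eventually_ge_atTop (1 + Real.log (1 + ε)),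
    hN.eventually_gt_atTop 0, hL.eventually_ge_atTop (1 + ε), ht.eventually_ge_atTop (2 / ε), hNk]
    with n hlog hN hL ht hNk
  have hL0 : 0 < L n := by linarith
  have ht0 : 0 < N n / L n := by positivity
  -- This makes room for an integer between the two multiples of `t₀` that bracket `M` below.
  have hεt : 1 ≤ ε / 2 * (N n / L n) := by
    rw [div_le_iff₀ hε] at ht
    linarith
  have htN : (1 + ε) * (N n / L n) ≤ N n := by
    rw [← mul_div_assoc, div_le_iff₀ hL0, mul_comm]
    exact mul_le_mul_of_nonneg_left hL hN.le
  set t₀ := N n / L n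
  set M := ⌈(1 + ε / 2) * t₀⌉₊ with hM
  have hx : 0 < (1 + ε / 2) * t₀ := by positivity
  have hM1 : (1 + ε / 2) * t₀ ≤ M := Nat.le_ceil _
  have hM2 : (M : ℝ) ≤ (1 + ε) * t₀ := by
    have := Nat.ceil_lt_add_one hx.le
    linarith
  have hM0 : 0 < M := Nat.ceil_pos.2 hx
  have hMk : M ≤ k n := by
    have : (M : ℝ) ≤ k n := by linarith
    exact_mod_cast this
  have hk : 0 < k n := hM0.trans_le hMk
  have hκ : (0 : ℝ) < k n := by exact_mod_cast hk
  have hcard : (0 : ℝ) < Fintype.card (G n) := by exact_mod_cast Fintype.card_pos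
  have hexp : (Fintype.card (G n) : ℝ) = Real.exp (N n) := by
    rw [hNdef, Real.exp_log hcard]
  have htail : poissonMass ((1 + ε) * t₀) (Set.Iio M)
      ≤ Real.exp (-((1 + ε) * t₀ * r)) := by
    refine poissonMass_le (by positivity) ha0 fun j hj => ?_
    have hj' := Nat.lt_ceil.1 (Set.mem_Iio.1 hj)
    refine mul_le_mul_of_nonpos_right ?_ (Real.log_nonpos ha0.le ha1.le)
    rw [ha, ← mul_assoc, div_mul_cancel₀ _ hε'.ne']
    exact hj'.le
  refine one_sub_le_measure_of_uniform (hZ_meas n) (hZ_indep n) (hZ_unif n)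
    (F := fun z => tvDist (generators z) ((1 + ε) * t₀)) (fun z => tvDist_nonneg _ _) hδ ?_
  have hsqrt : √(Fintype.card (G n) * (Real.exp 1 * M / k n) ^ M)
      ≤ √(Real.exp (-(ε / 2 * N n))) := by
    refine Real.sqrt_le_sqrt ?_
    rw [hexp]
    exact exp_mul_pow_le hN hκ hε (hLdef n) hL0 hlog hM1 hM2
  have hcardz : (((Finset.univ : Finset (Fin (k n) → G n)).card : ℕ) : ℝ)
      = (Fintype.card (G n) : ℝ) ^ k n := by simp
  calc ∑ z : Fin (k n) → G n, tvDist (generators z) ((1 + ε) * t₀)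
      ≤ ∑ z : Fin (k n) → G n, (poissonMass ((1 + ε) * t₀) (Set.Iio M) + wordDist z M / 2) :=
        Finset.sum_le_sum fun z _ => tvDist_le z hk (by positivity) M
    _ = (Fintype.card (G n) : ℝ) ^ k n * poissonMass ((1 + ε) * t₀) (Set.Iio M)
          + (∑ z : Fin (k n) → G n, wordDist z M) / 2 := by
        rw [Finset.sum_add_distrib, Finset.sum_const, nsmul_eq_mul, hcardz, Finset.sum_div]
    _ ≤ (Fintype.card (G n) : ℝ) ^ k n * Real.exp (-((1 + ε) * t₀ * r))
          + ((Fintype.card (G n) : ℝ) ^ k n * √(Real.exp (-(ε / 2 * N n)))) / 2 := by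
        gcongr
        exact (average_wordDist_le hM0 hMk).trans (by gcongr)
    _ = _ := by simp only [hb]; ring

end Cutoff

theorem theorem1p2
    {G : ℕ → Type*} [∀ n, Group (G n)] [∀ n, Fintype (G n)]
    [∀ n, MeasurableSpace (G n)] [∀ n, DiscreteMeasurableSpace (G n)]
    (hG : Tendsto (fun n => Fintype.card (G n)) atTop atTop)
    (H : ∀ n, Subgroup (G n)) (hnormal : ∀ n, (H n).Normal)
    (habelian : ∀ n, ∀ a ∈ H n, ∀ b ∈ H n, a * b = b * a)
    (hindex : BddAbove (Set.range fun n => (H n).index))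
    (k : ℕ → ℕ)
    (hk_large : (fun n => Real.log (Fintype.card (G n))) =o[atTop] (fun n => (k n : ℝ)))
    (hk_small : (fun n => Real.log (k n)) =o[atTop]
      (fun n => Real.log (Fintype.card (G n))))
    {Ω : ℕ → Type*} [∀ n, MeasurableSpace (Ω n)]
    (μ : ∀ n, Measure (Ω n)) [∀ n, IsProbabilityMeasure (μ n)]
    (Z : ∀ n, Fin (k n) → Ω n → G n)
    (hZ_meas : ∀ n i, Measurable (Z n i))
    (hZ_indep : ∀ n, iIndepFun (Z n) (μ n))
    (hZ_unif : ∀ n i, (μ n).map (Z n i) = uniformOn (Set.univ : Set (G n))) :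
    CutoffWHP μ (fun n ω => generators (fun i => Z n i ω))
      (fun n => Real.log (Fintype.card (G n)) /
        Real.log ((k n : ℝ) / Real.log (Fintype.card (G n)))) := by
  set N : ℕ → ℝ := fun n => Real.log (Fintype.card (G n))
  set L : ℕ → ℝ := fun n => Real.log ((k n : ℝ) / N n)
  have hN : Tendsto N atTop atTop :=
    Real.tendsto_log_atTop.comp (tendsto_natCast_atTop_atTop.comp hG)
  have hNk : ∀ᶠ n in atTop, N n ≤ k n := by
    filter_upwards [hk_large.bound zero_lt_one] with n h
    rw [one_mul, Real.norm_natCast] at h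
    exact (le_abs_self _).trans h
  have hκ : ∀ᶠ n in atTop, (0 : ℝ) < k n := by
    filter_upwards [hNk, hN.eventually_gt_atTop 0] with n h1 h2
    exact h2.trans_le h1
  have hL : Tendsto L atTop atTop :=
    Real.tendsto_log_atTop.comp (tendsto_div_atTop_of_isLittleO hN hk_large hκ)
  have ht : Tendsto (fun n => N n / L n) atTop atTop := tendsto_cutoff_time hN hL hκ hk_small
  obtain ⟨B, hB⟩ := hindex
  have hB' : ∀ n, (H n).index ≤ B := fun n => hB (Set.mem_range_self n)
  refine ⟨fun ε hε hε1 δ hδ => ?_, fun ε hε δ hδ => ?_⟩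
  · refine tendsto_const_nhds.congr' ?_
    filter_upwards [eventually_le_tvDist H hnormal habelian hB' (fun _ => rfl) (fun _ => rfl)
      hN hL ht hNk hε hε1 hδ] with n hn
    rw [← measure_univ (μ := μ n)]
    congr 1
    exact (Set.eq_univ_of_forall fun ω => hn fun i => Z n i ω).symm
  · exact tendsto_measure_tvDist_le μ hZ_meas hZ_indep hZ_unif (fun _ => rfl) (fun _ => rfl)
      hN hL ht hNk hε hδ
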